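/- Let $\mathcal A$ be a (not necessarily unital) complex $C^*$-algebra. A projection $p=p^*=p^2\in\mathcal A$ is called minimal if $p\mathcal A p=\mathbb C p$, and $\mathcal I^{At}(\mathcal A)$ denotes the $C^*$-subalgebra (norm-closed $*$-subalgebra) of $\mathcal A$ generated by all minimal projections of $\mathcal A$. By an ideal of $\mathcal A$ we mean a norm-closed two-sided ideal (such an ideal is automatically self-adjoint); an ideal $\mathcal I$ is essential if $\mathcal I\cap\mathcal J\neq\{0\}$ for every nonzero ideal $\mathcal J$ of $\mathcal A$. For a complex Hilbert space $\mathcal H$, $\mathcal K(\mathcal H)$ is the $C^*$-algebra of compact operators on $\mathcal H$; subalgebras of $\mathcal K(\mathcal H)$ are $C^*$-subalgebras and isomorphisms are $*$-isomorphisms. Then: \begin{enumerate} \item $\mathcal I^{At}(\mathcal A)$ is an ideal of $\mathcal A$; \item $\mathcal I^{At}(\mathcal A)$ is isomorphic to a subalgebra of $\mathcal K(\mathcal H)$ for some Hilbert space $\mathcal H$; \item every ideal of $\mathcal A$ that is isomorphic to a subalgebra of $\mathcal K(\mathcal H)$ for some Hilbert space $\mathcal H$ is contained in $\mathcal I^{At}(\mathcal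 A)$; \item if an essential ideal $\mathcal I$ of $\mathcal A$ is isomorphic to a subalgebra of $\mathcal K(\mathcal H)$ for some Hilbert space $\mathcal H$, then $\mathcal I=\mathcal I^{At}(\mathcal A)$. \end{enumerate} -/

import Mathlib

universe u v

namespace CStarAtoms

section Defs

variable {A : Type u} [NonUnitalCStarAlgebra A]

/-- A minimal projection of a (not necessarily unital) C⋆-algebra `A`: a self-adjoint idempotent
`p` with `p A p = ℂ p`. The projection `0` formally satisfies this; whether it is counted or not
makes no difference to the algebra generated by the minimal projections. -/
structure IsMinimalProjection (p : A) : Prop where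
  isStarProjection : IsStarProjection p
  corner_eq : Set.range (fun a : A => p * a * p) = Set.range (fun c : ℂ => c • p)

variable (A) in
/-- The C⋆-subalgebra (i.e. norm-closed `*`-subalgebra) of `A` generated by the minimal
projections of `A`. -/
noncomputable def atomicIdeal : NonUnitalStarSubalgebra ℂ A :=
  (NonUnitalStarAlgebra.adjoin ℂ {p : A | IsMinimalProjection p}).topologicalClosure

/-- A linear subspace of a C⋆-algebra is an ideal if it is norm-closed and absorbs multiplication
on both sides. -/
structure IsClosedIdeal (I : Submodule ℂ A) : Prop where
  isClosed : IsClosed (I : Set A)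
  mul_mem_left : ∀ (a : A) {x : A}, x ∈ I → a * x ∈ I
  mul_mem_right : ∀ (a : A) {x : A}, x ∈ I → x * a ∈ I

/-- A closed two-sided ideal of a C⋆-algebra is self-adjoint. -/
theorem IsClosedIdeal.star_mem {I : Submodule ℂ A} (hI : IsClosedIdeal I) {x : A} (hx : x ∈ I) :
    star x ∈ I := by
  have hmem : x * star x ∈ I := hI.mul_mem_right _ hx
  have hsa : IsSelfAdjoint (x * star x) := .mul_star_self x
  set h : A := x * star x with hh
  rw [← SetLike.mem_coe, ← hI.isClosed.closure_eq, Metric.mem_closure_iff]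
  intro ε hε
  -- approximate `star x` by `star x * f h` with `f t = n t² / (1 + n t²)`
  obtain ⟨n, hn⟩ : ∃ n : ℝ, n = 1 / ε ^ 4 := ⟨_, rfl⟩
  have hn0 : 0 < n := by rw [hn]; positivity
  have hpos : ∀ t : ℝ, 0 < 1 + n * t ^ 2 := fun t => by positivity
  let g : ℝ → ℝ := fun t => n * t / (1 + n * t ^ 2)
  let f : ℝ → ℝ := fun t => t * g t
  have hg : Continuous g := by
    refine Continuous.div (by fun_prop) (by fun_prop) fun t => (hpos t).ne'
  have hf : Continuous f := continuous_id.mul hg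
  have hg0 : g 0 = 0 := by simp [g]
  have hf0 : f 0 = 0 := by simp [f]
  have hid : cfcₙ (fun t : ℝ => t) h = h := cfcₙ_id' ℝ h
  have e1 : cfcₙ f h = h * cfcₙ g h := by
    have := cfcₙ_mul (fun t : ℝ => t) g h (by fun_prop) rfl hg.continuousOn hg0
    rwa [hid] at this
  have e2 : cfcₙ (fun t => t * f t) h = h * cfcₙ f h := by
    have := cfcₙ_mul (fun t : ℝ => t) f h (by fun_prop) rfl hf.continuousOn hf0
    rwa [hid] at this
  have hc : Continuous fun t => t - t * f t := by fun_prop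
  have e3 : cfcₙ (fun t => t - t * f t) h = h - h * cfcₙ f h := by
    have := cfcₙ_sub (fun t : ℝ => t) (fun t => t * f t) h (by fun_prop) rfl (by fun_prop)
      (by simp)
    rwa [hid, e2] at this
  have e4 : cfcₙ (fun t => f t * (t - t * f t)) h = cfcₙ f h * (h - h * cfcₙ f h) := by
    rw [← e3]
    exact cfcₙ_mul f _ h hf.continuousOn hf0 hc.continuousOn (by simp)
  have e5 : cfcₙ (fun t => (t - t * f t) - f t * (t - t * f t)) h =
      (h - h * cfcₙ f h) - cfcₙ f h * (h - h * cfcₙ f h) := by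
    rw [← e4, ← e3]
    exact cfcₙ_sub _ _ h hc.continuousOn (by simp) (by fun_prop) (by simp)
  have hfs : star (cfcₙ f h) = cfcₙ f h := (cfcₙ_predicate f h : IsSelfAdjoint _)
  refine ⟨star x * cfcₙ f h, hI.mul_mem_left _ (e1 ▸ hI.mul_mem_right _ hmem), ?_⟩
  have key : star (star x - star x * cfcₙ f h) * (star x - star x * cfcₙ f h) =
      (h - h * cfcₙ f h) - cfcₙ f h * (h - h * cfcₙ f h) := by
    rw [star_sub, star_mul, star_star, hfs, hh]
    simp only [sub_mul, mul_sub, mul_assoc]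
    abel
  have hnorm : ‖star x - star x * cfcₙ f h‖ * ‖star x - star x * cfcₙ f h‖ ≤ ε ^ 2 / 2 := by
    rw [← CStarRing.norm_star_mul_self, key, ← e5]
    refine norm_cfcₙ_le fun t _ => ?_
    have e : (t - t * f t) - f t * (t - t * f t) = t / (1 + n * t ^ 2) ^ 2 := by
      have := (hpos t).ne'
      simp only [f, g]
      field_simp
      ring
    rw [e, norm_div, norm_pow, Real.norm_eq_abs, Real.norm_eq_abs, abs_of_pos (hpos t),
      div_le_iff₀ (by have := hpos t; positivity)]
    have h1 : 1 + n * t ^ 2 ≤ (1 + n * t ^ 2) ^ 2 := by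
      have : 0 ≤ n * t ^ 2 := by positivity
      nlinarith
    have h2 : |t| ≤ ε ^ 2 / 2 * (1 + n * t ^ 2) := by
      have : ε ^ 2 / 2 * (1 + n * t ^ 2) - |t| = (ε ^ 2 - |t|) ^ 2 / (2 * ε ^ 2) := by
        rw [hn, ← sq_abs t]
        field_simp
        ring
      have h3 : 0 ≤ (ε ^ 2 - |t|) ^ 2 / (2 * ε ^ 2) := by positivity
      linarith
    exact h2.trans (by gcongr)
  rw [dist_eq_norm]
  have := norm_nonneg (star x - star x * cfcₙ f h)
  by_contra! hcon
  nlinarith [mul_le_mul hcon hcon hε.le this, pow_pos hε 2]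

/-- A closed two-sided ideal, viewed as a `*`-subalgebra. -/
def IsClosedIdeal.toStarSubalgebra {I : Submodule ℂ A} (hI : IsClosedIdeal I) :
    NonUnitalStarSubalgebra ℂ A where
  carrier := I
  add_mem' := I.add_mem
  zero_mem' := I.zero_mem
  mul_mem' := fun {a _} _ hb => hI.mul_mem_left a hb
  smul_mem' := fun c _ hx => I.smul_mem c hx
  star_mem' := fun hx => hI.star_mem hx

/-- An ideal is essential if it meets every nonzero ideal in a nonzero subspace. -/
def IsEssentialIdeal (I : Submodule ℂ A) : Prop :=
  IsClosedIdeal I ∧ ∀ J : Submodule ℂ A, IsClosedIdeal J → J ≠ ⊥ → I ⊓ J ≠ ⊥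

/-- `B` is `*`-isomorphic to a C⋆-subalgebra of the algebra of compact operators on some complex
Hilbert space (in the universe `v`). -/
def IsIsoToCompactSubalgebra (B : NonUnitalStarSubalgebra ℂ A) : Prop :=
  ∃ (H : Type v) (_ : NormedAddCommGroup H) (_ : InnerProductSpace ℂ H) (_ : CompleteSpace H)
    (C : NonUnitalStarSubalgebra ℂ (H →L[ℂ] H)),
    IsClosed (C : Set (H →L[ℂ] H)) ∧ (∀ T ∈ C, IsCompactOperator T) ∧ Nonempty (B ≃⋆ₐ[ℂ] C)

end Defs

end CStarAtoms

/-!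
Let `p` be a minimal projection. If `x p = x`, then `x⋆ x = ‖x‖² p` because `x⋆ x ∈ p A p`, and
hence `x x⋆` is a multiple of a minimal projection. Polarization turns `x x⋆` into `a p`, so the
linear span of the minimal projections is already a two-sided ideal; its closure is `atomicIdeal A`.

Suppose an ideal `I` is represented faithfully by compact operators. A soft threshold of the
functional calculus approximates a self-adjoint `x ∈ I` by self-adjoint `f` with `e f = f e = f`
for some `e ∈ I`. The range of `f` is fixed by the compact operator `e`, so it is
finite-dimensional, and so is the corner `f A f`. Then `f` has finite spectrum, and its spectral
projections split, by induction on the dimension of their corners, into sums of minimal projections.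

For a minimal projection `p ≠ 0`, the left ideal `A p` is a Hilbert space for `⟪x, y⟫ p = x⋆ y`. Let
`A` act by left multiplication on the Hilbert sum of the `A p`, where `p` runs through one
representative of each Murray–von Neumann class. An atom `q` then acts on a single summand, as the
operator of rank one given by a partial isometry from `p` to `q`.

Finally, if a minimal projection `p` is not in an ideal `I`, then `x p = 0` for all `x ∈ I`, since
`(x p)⋆ (x p) ∈ I` is a multiple of `p`. So an essential ideal contains every minimal projection.
-/

universe w

namespace CStarAtoms

section Polarization

variable {B : Type*} [NonUnitalRing B] [StarRing B] [Module ℂ B] [StarModule ℂ B]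
  [IsScalarTower ℂ B B] [SMulCommClass ℂ B B]

theorem four_smul_mul_star (x y : B) :
    (4 : ℂ) • (x * star y) = ∑ k ∈ Finset.range 4,
      Complex.I ^ k • ((x + Complex.I ^ k • y) * star (x + Complex.I ^ k • y)) := by
  have I_pow_six : Complex.I ^ 6 = -1 := by simp [Complex.I_pow_eq_pow_mod 6]
  have I_pow_nine : Complex.I ^ 9 = Complex.I := by simp [Complex.I_pow_eq_pow_mod 9]
  simp only [star_add, star_smul, star_pow, RCLike.star_def, Complex.conj_I, add_mul, mul_add,
    smul_mul_assoc, mul_smul_comm, smul_add, smul_smul, Finset.sum_range_succ,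
    Finset.sum_range_zero]
  match_scalars <;>
    (ring_nf; norm_num [Complex.I_sq, Complex.I_pow_three, Complex.I_pow_four, I_pow_six,
      I_pow_nine])

theorem mul_star_mem_of_forall_mul_star_self_mem {L S : Submodule ℂ B}
    (hLS : ∀ z ∈ L, z * star z ∈ S) {x y : B} (hx : x ∈ L) (hy : y ∈ L) : x * star y ∈ S := by
  rw [← S.smul_mem_iff (by norm_num : (4 : ℂ) ≠ 0), four_smul_mul_star]
  exact S.sum_mem fun k _ => S.smul_mem _ (hLS _ (L.add_mem hx (L.smul_mem _ hy)))

end Polarization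

section LeftIdeal

variable (𝕜 : Type*) {B : Type*} [CommSemiring 𝕜] [NonUnitalNonAssocSemiring B] [Module 𝕜 B]
  [IsScalarTower 𝕜 B B]

/-- The left ideal `B p` of an idempotent `p`, as the space of the `x` with `x p = x`. -/
def leftIdeal (p : B) : Submodule 𝕜 B :=
  LinearMap.eqLocus (LinearMap.mulRight 𝕜 p) LinearMap.id

variable {𝕜}

theorem mem_leftIdeal {p x : B} : x ∈ leftIdeal 𝕜 p ↔ x * p = x := Iff.rfl

end LeftIdeal

theorem mul_star_eq_star_iff {B : Type*} [Mul B] [StarMul B] {p x : B} (hp : IsSelfAdjoint p) :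
    p * star x = star x ↔ x * p = x := by
  rw [← star_inj, star_mul, star_star, hp.star_eq]

section MinimalProjection

variable {A : Type u} [NonUnitalCStarAlgebra A] {p : A}

theorem isMinimalProjection_iff :
    IsMinimalProjection p ↔ IsStarProjection p ∧ ∀ a, ∃ c : ℂ, p * a * p = c • p := by
  constructor
  · rintro ⟨hp, hcorner⟩
    refine ⟨hp, fun a => ?_⟩
    obtain ⟨c, hc⟩ := hcorner.subset ⟨a, rfl⟩
    exact ⟨c, hc.symm⟩
  · rintro ⟨hp, hscalar⟩
    refine ⟨hp, Set.Subset.antisymm ?_ ?_⟩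
    · rintro _ ⟨a, rfl⟩
      obtain ⟨c, hc⟩ := hscalar a
      exact ⟨c, hc.symm⟩
    · rintro _ ⟨c, rfl⟩
      exact ⟨c • p, by simp only [mul_smul_comm, smul_mul_assoc, hp.isIdempotentElem.eq]⟩

namespace IsMinimalProjection

theorem exists_mul_mul_eq_smul (hp : IsMinimalProjection p) (a : A) : ∃ c : ℂ, p * a * p = c • p :=
  (isMinimalProjection_iff.1 hp).2 a

theorem mul_self (hp : IsMinimalProjection p) : p * p = p :=
  hp.isStarProjection.isIdempotentElem

theorem star_eq (hp : IsMinimalProjection p) : star p = p :=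
  hp.isStarProjection.isSelfAdjoint

theorem star_mul_self_eq (hp : IsMinimalProjection p) {x : A} (hx : x * p = x) :
    star x * x = ((‖x‖ ^ 2 : ℝ) : ℂ) • p := by
  rcases eq_or_ne p 0 with rfl | hp0
  · obtain rfl : x = 0 := by rw [← hx, mul_zero]
    simp
  have hpx : p * star x = star x := (mul_star_eq_star_iff hp.isStarProjection.isSelfAdjoint).2 hx
  obtain ⟨c, hc⟩ : ∃ c : ℂ, star x * x = c • p := by
    obtain ⟨c, hc⟩ := hp.exists_mul_mul_eq_smul (star x * x)
    exact ⟨c, by rw [← hc, ← mul_assoc, hpx, mul_assoc, hx]⟩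
  have c_real : ((c.re : ℝ) : ℂ) = c := by
    have hself : star c • p = c • p := by
      rw [← hp.star_eq, ← star_smul, hp.star_eq, ← hc, star_mul, star_star]
    exact Complex.conj_eq_iff_re.1 (smul_left_injective ℂ hp0 hself)
  have c_nonneg : 0 ≤ c.re := by
    let _ := CStarAlgebra.spectralOrder A
    have _ := CStarAlgebra.spectralOrderedRing A
    have h : (0 : ℝ) • p ≤ c.re • p := by
      rw [zero_smul, ← Complex.coe_smul, c_real, ← hc]
      exact star_mul_self_nonneg x
    exact le_of_smul_le_smul_right h (hp.isStarProjection.nonneg.lt_of_ne' hp0)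
  have norm_p : ‖p‖ = 1 := by
    have hnorm := CStarRing.norm_star_mul_self (x := p)
    rw [hp.star_eq, hp.mul_self] at hnorm
    exact (mul_eq_left₀ (norm_ne_zero_iff.2 hp0)).1 hnorm.symm
  have norm_c : ‖x‖ ^ 2 = c.re := by
    rw [sq, ← CStarRing.norm_star_mul_self, hc, norm_smul, norm_p, mul_one, ← c_real,
      Complex.norm_real, Real.norm_of_nonneg c_nonneg, Complex.ofReal_re]
  rw [hc, norm_c, c_real]

theorem exists_mul_star_self_eq_smul (hp : IsMinimalProjection p) {x : A} (hx : x * p = x) :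
    ∃ q : A, IsMinimalProjection q ∧ x * star x = ((‖x‖ ^ 2 : ℝ) : ℂ) • q := by
  rcases eq_or_ne x 0 with rfl | hx0
  · exact ⟨p, hp, by simp⟩
  have hpx : p * star x = star x := (mul_star_eq_star_iff hp.isStarProjection.isSelfAdjoint).2 hx
  set l : ℂ := ((‖x‖ ^ 2 : ℝ) : ℂ) with hl
  have hl0 : l ≠ 0 := by simpa [hl] using hx0
  have star_l : star l = l := Complex.conj_ofReal _
  have sandwich (a : A) : ∃ c : ℂ, x * star x * a * (x * star x) = c • (x * star x) := by
    obtain ⟨c, hc⟩ := hp.exists_mul_mul_eq_smul (star x * a * x)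
    have hcp : star x * a * x = c • p := by
      rw [← hc, ← mul_assoc, ← mul_assoc, hpx, mul_assoc _ x, hx]
    refine ⟨c, ?_⟩
    calc x * star x * a * (x * star x) = x * (star x * a * x) * star x := by simp only [mul_assoc]
      _ = c • (x * star x) := by rw [hcp, mul_smul_comm, smul_mul_assoc, hx]
  refine ⟨l⁻¹ • (x * star x), isMinimalProjection_iff.2 ⟨⟨?_, ?_⟩, fun a => ?_⟩,
    (smul_inv_smul₀ hl0 _).symm⟩
  · rw [IsIdempotentElem, smul_mul_smul_comm, mul_assoc x, ← mul_assoc (star x),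
      hp.star_mul_self_eq hx, ← hl, smul_mul_assoc, hpx, mul_smul_comm, smul_smul, mul_assoc,
      inv_mul_cancel₀ hl0, mul_one]
  · rw [IsSelfAdjoint, star_smul, star_mul, star_star, star_inv₀, star_l]
  · obtain ⟨c, hc⟩ := sandwich a
    exact ⟨l⁻¹ * c, by rw [smul_mul_assoc, smul_mul_assoc, mul_smul_comm, hc, mul_smul,
      smul_comm c]⟩

end IsMinimalProjection

end MinimalProjection

section Socle

variable (A : Type u) [NonUnitalCStarAlgebra A]

/-- The linear span of the minimal projections: the algebraic ideal of which `atomicIdeal A` is the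
closure. -/
def socle : Submodule ℂ A := Submodule.span ℂ {p | IsMinimalProjection p}

variable {A} {p x : A}

theorem IsMinimalProjection.mem_socle (hp : IsMinimalProjection p) : p ∈ socle A :=
  Submodule.subset_span hp

theorem IsMinimalProjection.mul_mem_socle (hp : IsMinimalProjection p) (a : A) :
    a * p ∈ socle A := by
  have hsquare : ∀ z ∈ leftIdeal ℂ p, z * star z ∈ socle A := fun z hz => by
    obtain ⟨q, hq, hzq⟩ := hp.exists_mul_star_self_eq_smul hz
    exact hzq ▸ (socle A).smul_mem _ hq.mem_socle
  have ha : a * p ∈ leftIdeal ℂ p := mem_leftIdeal.2 (by rw [mul_assoc, hp.mul_self])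
  have hmem := mul_star_mem_of_forall_mul_star_self_mem hsquare ha (mem_leftIdeal.2 hp.mul_self)
  rwa [hp.star_eq, mem_leftIdeal.1 ha] at hmem

theorem mul_mem_socle_left (a : A) (hx : x ∈ socle A) : a * x ∈ socle A := by
  have hle : socle A ≤ (socle A).comap (LinearMap.mulLeft ℂ a) :=
    Submodule.span_le.2 fun _ hp => hp.mul_mem_socle a
  exact hle hx

theorem star_mem_socle (hx : x ∈ socle A) : star x ∈ socle A := by
  induction hx using Submodule.span_induction with
  | mem p hp => exact (IsMinimalProjection.star_eq hp).symm ▸ IsMinimalProjection.mem_socle hp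
  | zero => simp
  | add x y _ _ hx hy => exact star_add x y ▸ add_mem hx hy
  | smul c x _ hx => exact star_smul c x ▸ (socle A).smul_mem _ hx

theorem mul_mem_socle_right (a : A) (hx : x ∈ socle A) : x * a ∈ socle A := by
  have hmem := star_mem_socle (mul_mem_socle_left (star a) (star_mem_socle hx))
  rwa [star_mul, star_star, star_star] at hmem

theorem toSubmodule_adjoin_isMinimalProjection :
    (NonUnitalStarAlgebra.adjoin ℂ {p : A | IsMinimalProjection p}).toSubmodule = socle A := by
  refine le_antisymm (fun x hx => ?_)
    (Submodule.span_le.2 (NonUnitalStarAlgebra.subset_adjoin ℂ _))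
  induction hx using NonUnitalStarAlgebra.adjoin_induction with
  | mem p hp => exact IsMinimalProjection.mem_socle hp
  | add x y _ _ hx hy => exact add_mem hx hy
  | zero => exact zero_mem _
  | mul x y _ _ _ hy => exact mul_mem_socle_left x hy
  | smul r x _ hx => exact (socle A).smul_mem r hx
  | star x _ hx => exact star_mem_socle hx

theorem toSubmodule_atomicIdeal :
    (atomicIdeal A).toSubmodule = (socle A).topologicalClosure := by
  rw [← toSubmodule_adjoin_isMinimalProjection]
  rfl

theorem atomicIdeal_le_iff {S : Submodule ℂ A} (hS : IsClosed (S : Set A)) :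
    (atomicIdeal A).toSubmodule ≤ S ↔ ∀ p : A, IsMinimalProjection p → p ∈ S := by
  rw [toSubmodule_atomicIdeal]
  exact ⟨fun h p hp => h ((socle A).le_topologicalClosure hp.mem_socle),
    fun h => (socle A).topologicalClosure_minimal (Submodule.span_le.2 h) hS⟩

variable (A) in
theorem isClosedIdeal_atomicIdeal : IsClosedIdeal (atomicIdeal A).toSubmodule := by
  rw [toSubmodule_atomicIdeal]
  exact
    { isClosed := (socle A).isClosed_topologicalClosure
      mul_mem_left a _ hx := map_mem_closure (continuous_const_mul a) hx
        fun _ => mul_mem_socle_left a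
      mul_mem_right a _ hx := map_mem_closure (f := (· * a)) (continuous_mul_const a) hx
        fun _ => mul_mem_socle_right a }

end Socle

section EssentialIdeal

variable {A : Type u} [NonUnitalCStarAlgebra A] {I : Submodule ℂ A}

/-- The right annihilator of `I`: all `a` with `x a = 0` for every `x ∈ I`. -/
def rightAnnihilator (I : Submodule ℂ A) : Submodule ℂ A :=
  ⨅ x ∈ I, LinearMap.ker (LinearMap.mulLeft ℂ x)

theorem mem_rightAnnihilator {a : A} : a ∈ rightAnnihilator I ↔ ∀ x ∈ I, x * a = 0 := by
  simp [rightAnnihilator]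

theorem IsClosedIdeal.rightAnnihilator (hI : IsClosedIdeal I) :
    IsClosedIdeal (rightAnnihilator I) where
  isClosed := by
    simp only [CStarAtoms.rightAnnihilator, Submodule.coe_iInf]
    exact isClosed_biInter fun x _ => isClosed_eq (continuous_const_mul x) continuous_const
  mul_mem_left b a ha := mem_rightAnnihilator.2 fun x hx => by
    rw [← mul_assoc, mem_rightAnnihilator.1 ha _ (hI.mul_mem_right b hx)]
  mul_mem_right b a ha := mem_rightAnnihilator.2 fun x hx => by
    rw [← mul_assoc, mem_rightAnnihilator.1 ha x hx, zero_mul]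

theorem IsClosedIdeal.disjoint_rightAnnihilator (hI : IsClosedIdeal I) :
    Disjoint I (CStarAtoms.rightAnnihilator I) :=
  Submodule.disjoint_def.2 fun x hx hann =>
    CStarRing.star_mul_self_eq_zero_iff x |>.1 (mem_rightAnnihilator.1 hann _ (hI.star_mem hx))

theorem IsEssentialIdeal.rightAnnihilator_eq_bot (hI : IsEssentialIdeal I) :
    rightAnnihilator I = ⊥ := by
  by_contra hne
  exact hI.2 _ hI.1.rightAnnihilator hne hI.1.disjoint_rightAnnihilator.eq_bot

theorem IsMinimalProjection.mem_or_mem_rightAnnihilator {p : A} (hp : IsMinimalProjection p)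
    (hI : IsClosedIdeal I) : p ∈ I ∨ p ∈ rightAnnihilator I := by
  by_contra! h
  obtain ⟨hpI, hann⟩ := h
  refine hann (mem_rightAnnihilator.2 fun x hx => ?_)
  have hmem : star (x * p) * (x * p) ∈ I := hI.mul_mem_left _ (hI.mul_mem_right _ hx)
  rw [hp.star_mul_self_eq (by rw [mul_assoc, hp.mul_self])] at hmem
  by_contra hxp
  exact hpI ((I.smul_mem_iff (by simpa using hxp)).1 hmem)

theorem IsEssentialIdeal.atomicIdeal_le (hI : IsEssentialIdeal I) :
    (atomicIdeal A).toSubmodule ≤ I := by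
  refine (atomicIdeal_le_iff hI.1.isClosed).2 fun p hp => ?_
  refine (hp.mem_or_mem_rightAnnihilator hI.1).elim id fun hann => ?_
  rw [hI.rightAnnihilator_eq_bot, Submodule.mem_bot] at hann
  exact hann ▸ I.zero_mem

end EssentialIdeal

section Corner

variable (𝕜 : Type*) {B C : Type*}

/-- The corner `x B x`, as a linear subspace. -/
def corner [CommSemiring 𝕜] [NonUnitalSemiring B] [Module 𝕜 B] [IsScalarTower 𝕜 B B]
    [SMulCommClass 𝕜 B B] (x : B) : Submodule 𝕜 B :=
  LinearMap.range (LinearMap.mulLeftRight 𝕜 (x, x))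

variable {𝕜}

section Semiring

variable [CommSemiring 𝕜] [NonUnitalSemiring B] [Module 𝕜 B] [IsScalarTower 𝕜 B B]
  [SMulCommClass 𝕜 B B] {x y e q : B}

theorem mem_corner : y ∈ corner 𝕜 x ↔ ∃ b, x * b * x = y := by
  simp only [corner, LinearMap.mem_range, LinearMap.mulLeftRight_apply]

theorem mul_mul_mem_corner (x b : B) : x * b * x ∈ corner 𝕜 x := mem_corner.2 ⟨b, rfl⟩

theorem corner_le_corner (h : y ∈ corner 𝕜 x) : corner 𝕜 y ≤ corner 𝕜 x := by
  obtain ⟨b, rfl⟩ := mem_corner.1 h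
  rintro _ ⟨c, rfl⟩
  rw [LinearMap.mulLeftRight_apply]
  simpa only [mul_assoc] using mul_mul_mem_corner (𝕜 := 𝕜) x (b * x * c * x * b)

theorem mem_corner_iff_of_isIdempotentElem (he : IsIdempotentElem e) :
    q ∈ corner 𝕜 e ↔ e * q = q ∧ q * e = q := by
  refine ⟨fun h => ?_, fun ⟨h₁, h₂⟩ => mem_corner.2 ⟨q, by rw [h₁, h₂]⟩⟩
  obtain ⟨b, rfl⟩ := mem_corner.1 h
  exact ⟨by rw [← mul_assoc, ← mul_assoc, he.eq], by rw [mul_assoc, he.eq]⟩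

theorem corner_lt_corner (he : IsIdempotentElem e) (hq : IsIdempotentElem q)
    (hqe : q ∈ corner 𝕜 e) (hne : q ≠ e) : corner 𝕜 q < corner 𝕜 e := by
  refine (corner_le_corner hqe).lt_of_ne fun h => hne ?_
  have heq : e ∈ corner 𝕜 q :=
    h ▸ (mem_corner_iff_of_isIdempotentElem he).2 ⟨he, he⟩
  rw [← ((mem_corner_iff_of_isIdempotentElem hq).1 heq).1,
    ((mem_corner_iff_of_isIdempotentElem he).1 hqe).2]

end Semiring

variable [Field 𝕜] [NonUnitalRing B] [Module 𝕜 B] [IsScalarTower 𝕜 B B] [SMulCommClass 𝕜 B B]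
  [NonUnitalRing C] [Module 𝕜 C] [IsScalarTower 𝕜 C C] [SMulCommClass 𝕜 C C]

theorem finiteDimensional_corner_of_injective {φ : B →ₙₐ[𝕜] C} (hφ : Function.Injective φ) {b : B}
    [FiniteDimensional 𝕜 (corner 𝕜 (φ b))] : FiniteDimensional 𝕜 (corner 𝕜 b) := by
  have hmaps : ∀ x ∈ corner 𝕜 b, φ x ∈ corner 𝕜 (φ b) := fun x hx => by
    obtain ⟨c, rfl⟩ := mem_corner.1 hx
    rw [map_mul, map_mul]
    exact mul_mul_mem_corner _ _
  exact .of_injective ((φ : B →ₗ[𝕜] C).restrict hmaps) fun x y hxy =>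
    Subtype.ext (hφ (congrArg Subtype.val hxy))

end Corner

section CompactOperator

variable {X : Type*} [NormedAddCommGroup X] [NormedSpace ℂ X]

theorem finiteDimensional_ker_one_sub {E : X →L[ℂ] X} (hE : IsCompactOperator E) :
    FiniteDimensional ℂ (LinearMap.ker ((1 - E : X →L[ℂ] X) : X →ₗ[ℂ] X)) := by
  set K := LinearMap.ker ((1 - E : X →L[ℂ] X) : X →ₗ[ℂ] X)
  have fixed : ∀ x ∈ K, E x = x := fun x hx => (sub_eq_zero.1 hx).symm
  have maps : ∀ x ∈ K, (E : X →ₗ[ℂ] X) x ∈ K := fun x hx => by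
    rwa [ContinuousLinearMap.coe_coe, fixed x hx]
  have restrict_eq_id : ((E : X →ₗ[ℂ] X).restrict maps : K → K) = id :=
    funext fun x => Subtype.ext (fixed x x.2)
  refine FiniteDimensional.of_isCompactOperator_id ?_
  rw [← restrict_eq_id]
  exact hE.restrict maps (1 - E).isClosed_ker

theorem finiteDimensional_corner_of_isCompactOperator {E F : X →L[ℂ] X}
    (hE : IsCompactOperator E) (hEF : E * F = F) : FiniteDimensional ℂ (corner ℂ F) := by
  have := finiteDimensional_ker_one_sub hE
  set K := LinearMap.ker ((1 - E : X →L[ℂ] X) : X →ₗ[ℂ] X)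
  have hFK (x : X) : F x ∈ K := sub_eq_zero.2 (DFunLike.congr_fun hEF x).symm
  let F' : X →L[ℂ] K := F.codRestrict K hFK
  let extend : (K →L[ℂ] K) →ₗ[ℂ] (X →L[ℂ] X) :=
    { toFun L := K.subtypeL ∘L L ∘L F'
      map_add' L M := by ext; simp
      map_smul' c L := by ext; simp }
  refine Submodule.finiteDimensional_of_le (S₂ := LinearMap.range extend) fun T hT => ?_
  obtain ⟨S, rfl⟩ := mem_corner.1 hT
  exact ⟨F' ∘L S ∘L K.subtypeL, rfl⟩

end CompactOperator

section Spectral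

variable {A : Type u} [NonUnitalCStarAlgebra A] {x e q : A}

theorem mul_cfcₙ_mul_self (x : A) [IsStarNormal x] {g : ℂ → ℂ}
    (hg : ContinuousOn g (quasispectrum ℂ x)) (hg0 : g 0 = 0) :
    x * cfcₙ g x * x = cfcₙ (fun t => t * g t * t) x := by
  rw [cfcₙ_mul (fun t => t * g t) (fun t => t) x (continuousOn_id.mul hg) (by simp)
    continuousOn_id rfl, cfcₙ_mul (fun t => t) g x continuousOn_id rfl hg hg0, cfcₙ_id' ℂ x]

/-- Functional calculus for the polynomials `t³ q(t)`, as a linear map in `q`. The factor `t³` puts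
all its values into `x A x`, also for constant `q`. -/
noncomputable def cubeMulAeval (x : A) : Polynomial ℂ →ₗ[ℂ] A where
  toFun q := cfcₙ (fun t : ℂ => t ^ 3 * q.eval t) x
  map_add' q r := by
    rw [← cfcₙ_add (fun t : ℂ => t ^ 3 * q.eval t) (fun t : ℂ => t ^ 3 * r.eval t) x]
    simp only [Polynomial.eval_add, mul_add]
  map_smul' c q := by
    rw [RingHom.id_apply, ← cfcₙ_smul c (fun t : ℂ => t ^ 3 * q.eval t) x]
    simp only [Polynomial.eval_smul, mul_smul_comm]

theorem cubeMulAeval_mem_corner (x : A) [IsStarNormal x] (q : Polynomial ℂ) :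
    cubeMulAeval x q ∈ corner ℂ x := by
  refine mem_corner.2 ⟨cfcₙ (fun t : ℂ => t * q.eval t) x, ?_⟩
  rw [mul_cfcₙ_mul_self x (by fun_prop) (zero_mul (q.eval 0))]
  exact cfcₙ_congr fun t _ => by ring

theorem finite_quasispectrum_of_finiteDimensional_corner (x : A) [IsStarNormal x]
    [FiniteDimensional ℂ (corner ℂ x)] : (quasispectrum ℂ x).Finite := by
  obtain ⟨q, hq, hq0⟩ : ∃ q, cubeMulAeval x q = 0 ∧ q ≠ 0 := by
    by_contra! hker
    have hinj : Function.Injective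
        ((cubeMulAeval x).codRestrict (corner ℂ x) (cubeMulAeval_mem_corner x)) :=
      (injective_iff_map_eq_zero _).2 fun q hq => hker q (congrArg Subtype.val hq)
    exact Polynomial.not_finite (R := ℂ) (Module.Finite.of_injective _ hinj)
  have hzero : cfcₙ (fun t : ℂ => t ^ 3 * q.eval t) x = cfcₙ (fun _ : ℂ => 0) x := by
    rw [cfcₙ_const_zero]
    exact hq
  have hne : Polynomial.X ^ 3 * q ≠ 0 := mul_ne_zero (pow_ne_zero 3 Polynomial.X_ne_zero) hq0
  refine (Polynomial.finite_setOfPred_isRoot hne).subset fun t ht => ?_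
  have hroot : t ^ 3 * q.eval t = 0 := (cfcₙ_eq_cfcₙ_iff_eqOn (a := x)).1 hzero ht
  simpa [Polynomial.IsRoot] using hroot

open Classical in
/-- The spectral projection of `x` for the value `l`. It is meaningful only if `l` is nonzero and
isolated in the spectrum: for other `l`, the value of `cfcₙ` may be the junk value `0`. -/
noncomputable def spectralProjection (x : A) (l : ℂ) : A := cfcₙ (Pi.single l 1 : ℂ → ℂ) x

theorem isStarProjection_spectralProjection (hx : (quasispectrum ℂ x).Finite)
    {l : ℂ} (hl : l ≠ 0) : IsStarProjection (spectralProjection x l) where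
  isIdempotentElem := by
    classical
    rw [IsIdempotentElem, spectralProjection, ← cfcₙ_mul _ _ x (hx.continuousOn _)
      (Pi.single_eq_of_ne hl.symm 1) (hx.continuousOn _) (Pi.single_eq_of_ne hl.symm 1)]
    exact cfcₙ_congr fun t _ => by by_cases htl : t = l <;> simp [htl]
  isSelfAdjoint := by
    classical
    rw [IsSelfAdjoint, spectralProjection, ← cfcₙ_star]
    exact cfcₙ_congr fun t _ => by by_cases htl : t = l <;> simp [htl]

theorem spectralProjection_mem_corner [IsStarNormal x] (hx : (quasispectrum ℂ x).Finite)
    {l : ℂ} (hl : l ≠ 0) : spectralProjection x l ∈ corner ℂ x := by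
  classical
  refine mem_corner.2 ⟨cfcₙ (Pi.single l (l ^ 2)⁻¹ : ℂ → ℂ) x, ?_⟩
  rw [mul_cfcₙ_mul_self x (hx.continuousOn _) (Pi.single_eq_of_ne hl.symm _), spectralProjection]
  refine cfcₙ_congr fun t _ => ?_
  rcases eq_or_ne t l with rfl | htl
  · simp only [Pi.single_eq_same]
    field_simp
  · simp only [Pi.single_eq_of_ne htl, mul_zero, zero_mul]

theorem sum_smul_spectralProjection [IsStarNormal x] (hx : (quasispectrum ℂ x).Finite) :
    ∑ l ∈ hx.toFinset.erase 0, l • spectralProjection x l = x := by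
  classical
  have single_zero {l : ℂ} (hl : l ∈ hx.toFinset.erase 0) : (Pi.single l 1 : ℂ → ℂ) 0 = 0 :=
    Pi.single_eq_of_ne (Finset.ne_of_mem_erase hl).symm 1
  calc ∑ l ∈ hx.toFinset.erase 0, l • spectralProjection x l
      = ∑ l ∈ hx.toFinset.erase 0, cfcₙ (fun t => l • (Pi.single l 1 : ℂ → ℂ) t) x :=
        Finset.sum_congr rfl fun l hl =>
          (cfcₙ_smul l _ x (hx.continuousOn _) (single_zero hl)).symm
    _ = cfcₙ (∑ l ∈ hx.toFinset.erase 0, fun t => l • (Pi.single l 1 : ℂ → ℂ) t) x :=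
        (cfcₙ_sum _ _ _ (fun l _ => hx.continuousOn _)
          fun l hl => by rw [single_zero hl, smul_zero]).symm
    _ = cfcₙ (fun t : ℂ => t) x := cfcₙ_congr fun t ht => by
        rcases eq_or_ne t 0 with rfl | ht0 <;> simp_all [Pi.single_apply]
    _ = x := cfcₙ_id' ℂ x

theorem mem_span_isStarProjection (x : A) [IsStarNormal x] [FiniteDimensional ℂ (corner ℂ x)] :
    x ∈ Submodule.span ℂ {e : A | IsStarProjection e ∧ e ∈ corner ℂ x} := by
  have hfin := finite_quasispectrum_of_finiteDimensional_corner x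
  refine Set.mem_of_eq_of_mem (sum_smul_spectralProjection hfin).symm <|
    Submodule.sum_mem _ fun l hl => Submodule.smul_mem _ l (Submodule.subset_span ?_)
  have hl0 : l ≠ 0 := Finset.ne_of_mem_erase hl
  exact ⟨isStarProjection_spectralProjection hfin hl0, spectralProjection_mem_corner hfin hl0⟩

theorem isMinimalProjection_of_forall_eq_zero_or_eq (he : IsStarProjection e)
    [FiniteDimensional ℂ (corner ℂ e)]
    (h : ∀ q ∈ corner ℂ e, IsStarProjection q → q = 0 ∨ q = e) : IsMinimalProjection e := by
  suffices hle : ∀ a, e * a * e ∈ Submodule.span ℂ {e} from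
    isMinimalProjection_iff.2 ⟨he, fun a =>
      (Submodule.mem_span_singleton.1 (hle a)).imp fun _ => Eq.symm⟩
  have hsa : ∀ a ∈ (selfAdjoint A : Set A), e * a * e ∈ Submodule.span ℂ {e} := fun a ha => by
    have : IsStarNormal (e * a * e) := by
      have hconj : IsSelfAdjoint (e * a * star e) := ha.conjugate e
      rw [he.isSelfAdjoint.star_eq] at hconj
      exact hconj.isStarNormal
    have hcorner : corner ℂ (e * a * e) ≤ corner ℂ e := corner_le_corner (mul_mul_mem_corner e a)
    have := Submodule.finiteDimensional_of_le hcorner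
    refine Submodule.span_le.2 ?_ (mem_span_isStarProjection (e * a * e))
    rintro q ⟨hq, hqe⟩
    rcases h q (hcorner hqe) hq with rfl | rfl
    · exact Submodule.zero_mem _
    · exact Submodule.mem_span_singleton_self _
  have htop : ⊤ ≤ (Submodule.span ℂ {e}).comap (LinearMap.mulLeftRight ℂ (e, e)) :=
    span_selfAdjoint (A := A) ▸ Submodule.span_le.2 hsa
  exact fun a => htop (x := a) trivial

theorem mem_socle_of_isStarProjection (he : IsStarProjection e) [FiniteDimensional ℂ (corner ℂ e)] :
    e ∈ socle A := by
  induction hn : Module.finrank ℂ (corner ℂ e) using Nat.strong_induction_on generalizing e with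
  | _ n ih =>
  by_cases hmin : ∀ q ∈ corner ℂ e, IsStarProjection q → q = 0 ∨ q = e
  · exact (isMinimalProjection_of_forall_eq_zero_or_eq he hmin).mem_socle
  have proper_mem {q : A} (hq : IsStarProjection q) (hqe : q ∈ corner ℂ e) (hne : q ≠ e) :
      q ∈ socle A := by
    have hlt := corner_lt_corner he.isIdempotentElem hq.isIdempotentElem hqe hne
    have := Submodule.finiteDimensional_of_le hlt.le
    exact ih _ (hn ▸ Submodule.finrank_lt_finrank_of_lt hlt) hq rfl
  push Not at hmin
  obtain ⟨q, hqe, hq, hq0, hne⟩ := hmin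
  have hee : e ∈ corner ℂ e :=
    (mem_corner_iff_of_isIdempotentElem he.isIdempotentElem).2
      ⟨he.isIdempotentElem, he.isIdempotentElem⟩
  have hsub : IsStarProjection (e - q) := hq.sub_of_mul_eq_left he
    ((mem_corner_iff_of_isIdempotentElem he.isIdempotentElem).1 hqe).2
  rw [← sub_add_cancel e q]
  exact add_mem (proper_mem hsub (sub_mem hee hqe) (sub_eq_self.not.2 hq0))
    (proper_mem hq hqe hne)

theorem mem_socle_of_finiteDimensional_corner (x : A) [IsStarNormal x]
    [FiniteDimensional ℂ (corner ℂ x)] : x ∈ socle A := by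
  refine Submodule.span_le.2 ?_ (mem_span_isStarProjection x)
  rintro e ⟨he, hex⟩
  have := Submodule.finiteDimensional_of_le (corner_le_corner hex)
  exact mem_socle_of_isStarProjection he

end Spectral

section SoftThreshold

theorem abs_div_max_sq_le (t : ℝ) {δ : ℝ} (hδ : 0 < δ) : |t / max (t ^ 2) (δ ^ 2)| ≤ δ⁻¹ := by
  have hmax : 0 < max (t ^ 2) (δ ^ 2) := lt_max_of_lt_right (by positivity)
  rw [abs_div, abs_of_pos hmax, div_le_iff₀ hmax, inv_mul_eq_div, le_div_iff₀ hδ]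
  have hamgm := two_mul_le_add_sq (|t|) δ
  rw [sq_abs] at hamgm
  linarith [le_max_left (t ^ 2) (δ ^ 2), le_max_right (t ^ 2) (δ ^ 2)]

/-- With `k t = t / max t² δ²`, the function `g t = t - δ² k t` vanishes for `|t| ≤ δ`, while
`t k t = 1` for `|t| ≥ δ`; take `y = k x` and `f = g x`. -/
theorem exists_softThreshold {A : Type*} [NonUnitalCStarAlgebra A] {x : A}
    (hx : IsSelfAdjoint x) {δ : ℝ} (hδ : 0 < δ) :
    ∃ y f : A, IsSelfAdjoint f ∧ x * y * f = f ∧ f * (x * y) = f ∧ ‖x - f‖ ≤ δ := by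
  let k : ℝ → ℝ := fun t => t / max (t ^ 2) (δ ^ 2)
  let g : ℝ → ℝ := fun t => t - δ ^ 2 * k t
  have hmax (t : ℝ) : max (t ^ 2) (δ ^ 2) ≠ 0 := (lt_max_of_lt_right (by positivity)).ne'
  have hk : Continuous k := continuous_id.div (by fun_prop) hmax
  have hg : Continuous g := by fun_prop
  have hk0 : k 0 = 0 := zero_div _
  have hg0 : g 0 = 0 := by simp only [g, hk0, mul_zero, sub_zero]
  have mul_k_mul_g (t : ℝ) : t * k t * g t = g t := by
    have hne := hmax t
    simp only [k, g]
    rcases max_choice (t ^ 2) (δ ^ 2) with h | h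
    · rw [h] at hne ⊢
      field_simp
    · rw [h] at hne ⊢
      field_simp
      ring
  have hxy : x * cfcₙ k x = cfcₙ (fun t => t * k t) x := by
    rw [cfcₙ_mul (fun t : ℝ => t) k x continuousOn_id rfl hk.continuousOn hk0, cfcₙ_id' ℝ x]
  have hxyf : x * cfcₙ k x * cfcₙ g x = cfcₙ g x := by
    rw [hxy, ← cfcₙ_mul (fun t => t * k t) g x (by fun_prop) (zero_mul _) hg.continuousOn hg0]
    simp only [mul_k_mul_g]
  have hsub : x - cfcₙ g x = cfcₙ (fun t => δ ^ 2 * k t) x := calc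
    x - cfcₙ g x = cfcₙ (fun t : ℝ => t) x - cfcₙ g x := by rw [cfcₙ_id' ℝ x]
    _ = cfcₙ (fun t : ℝ => t - g t) x :=
      (cfcₙ_sub (fun t : ℝ => t) g x continuousOn_id rfl hg.continuousOn hg0).symm
    _ = cfcₙ (fun t => δ ^ 2 * k t) x := by simp only [g, sub_sub_cancel]
  refine ⟨cfcₙ k x, cfcₙ g x, .cfcₙ, hxyf, ?_, ?_⟩
  · rw [hxy, (cfcₙ_commute_cfcₙ g (fun t => t * k t) x).eq, ← hxy, hxyf]
  · rw [hsub]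
    refine norm_cfcₙ_le fun t _ => ?_
    rw [norm_mul, Real.norm_of_nonneg (sq_nonneg δ), Real.norm_eq_abs]
    calc δ ^ 2 * |k t| ≤ δ ^ 2 * δ⁻¹ := by gcongr; exact abs_div_max_sq_le t hδ
      _ = δ := by field_simp

end SoftThreshold

section CompactRepresentation

/-- `B` has an injective algebra homomorphism, neither continuous nor `*`-preserving in general,
into the compact operators of some complex normed space (in the universe `w`). -/
def HasFaithfulCompactRep (B : Type*) [NonUnitalRing B] [Module ℂ B] : Prop :=
  ∃ (X : Type w) (_ : NormedAddCommGroup X) (_ : NormedSpace ℂ X) (φ : B →ₙₐ[ℂ] (X →L[ℂ] X)),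
    Function.Injective φ ∧ ∀ b, IsCompactOperator (φ b)

variable {A : Type u} [NonUnitalCStarAlgebra A]

theorem IsIsoToCompactSubalgebra.hasFaithfulCompactRep {B : NonUnitalStarSubalgebra ℂ A}
    (h : IsIsoToCompactSubalgebra.{u, v} B) : HasFaithfulCompactRep.{v} B := by
  obtain ⟨H, _, _, _, C, -, hC, ⟨φ⟩⟩ := h
  exact ⟨H, _, _, (NonUnitalSubalgebraClass.subtype C).comp (φ : B →ₙₐ[ℂ] C),
    Subtype.val_injective.comp φ.injective, fun b => hC _ (φ b).2⟩

theorem HasFaithfulCompactRep.finiteDimensional_corner {B : Type*} [NonUnitalRing B] [Module ℂ B]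
    [IsScalarTower ℂ B B] [SMulCommClass ℂ B B] (h : HasFaithfulCompactRep.{w} B) {e f : B}
    (hef : e * f = f) : FiniteDimensional ℂ (corner ℂ f) := by
  obtain ⟨X, _, _, φ, hφ, hcompact⟩ := h
  have := finiteDimensional_corner_of_isCompactOperator (F := φ f) (hcompact e)
    (by rw [← map_mul, hef])
  exact finiteDimensional_corner_of_injective hφ

/-- The corner of `f` in `A` agrees with its corner in `I`, since `f a f = f (e a) f`. -/
theorem IsClosedIdeal.finiteDimensional_corner {I : Submodule ℂ A} (hI : IsClosedIdeal I)
    (hrep : HasFaithfulCompactRep.{w} hI.toStarSubalgebra) {e f : A} (he : e ∈ I)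
    (hef : e * f = f) (hfe : f * e = f) : FiniteDimensional ℂ (corner ℂ f) := by
  let e' : hI.toStarSubalgebra := ⟨e, he⟩
  let f' : hI.toStarSubalgebra := ⟨f, hef ▸ hI.mul_mem_right f he⟩
  have := hrep.finiteDimensional_corner (Subtype.ext hef : e' * f' = f')
  refine Submodule.finiteDimensional_of_le (S₂ := (corner ℂ f').map
    (NonUnitalSubalgebraClass.subtype hI.toStarSubalgebra : hI.toStarSubalgebra →ₗ[ℂ] A)) ?_
  intro x hx
  obtain ⟨a, rfl⟩ := mem_corner.1 hx
  refine ⟨_, mul_mul_mem_corner f' ⟨e * a, hI.mul_mem_right a he⟩, ?_⟩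
  change f * (e * a) * f = f * a * f
  rw [← mul_assoc f e, hfe]

theorem IsClosedIdeal.mem_atomicIdeal_of_isSelfAdjoint {I : Submodule ℂ A} (hI : IsClosedIdeal I)
    (hrep : HasFaithfulCompactRep.{w} hI.toStarSubalgebra) {x : A} (hx : x ∈ I)
    (hsa : IsSelfAdjoint x) : x ∈ (atomicIdeal A).toSubmodule := by
  rw [toSubmodule_atomicIdeal]
  refine Metric.mem_closure_iff.2 fun ε hε => ?_
  obtain ⟨y, f, hf, hef, hfe, hdist⟩ := exists_softThreshold hsa (half_pos hε)
  have := hI.finiteDimensional_corner hrep (hI.mul_mem_right y hx) hef hfe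
  have := hf.isStarNormal
  exact ⟨f, mem_socle_of_finiteDimensional_corner f,
    (dist_eq_norm x f).trans_lt (hdist.trans_lt (half_lt_self hε))⟩

theorem IsClosedIdeal.le_atomicIdeal {I : Submodule ℂ A} (hI : IsClosedIdeal I)
    (hrep : HasFaithfulCompactRep.{w} hI.toStarSubalgebra) :
    I ≤ (atomicIdeal A).toSubmodule := by
  have hspan : ⊤ ≤ (atomicIdeal A).toSubmodule.comap
      (NonUnitalSubalgebraClass.subtype hI.toStarSubalgebra : hI.toStarSubalgebra →ₗ[ℂ] A) := by
    rw [← span_selfAdjoint]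
    exact Submodule.span_le.2 fun x hx =>
      hI.mem_atomicIdeal_of_isSelfAdjoint hrep x.2 (congrArg Subtype.val hx)
  exact fun x hx => hspan (x := ⟨x, hx⟩) trivial

end CompactRepresentation

section MurrayVonNeumann

variable {B : Type*} [NonUnitalNormedRing B] [StarRing B] [CStarRing B] {p v : B}

theorem mul_eq_self_of_star_mul_self_eq (hp : IsStarProjection p) (hv : star v * v = p) :
    v * p = v := by
  have hzero : star (v * p - v) * (v * p - v) = 0 := by
    simp only [star_sub, star_mul, hp.isSelfAdjoint.star_eq, sub_mul, mul_sub, mul_assoc,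
      ← mul_assoc (star v), hv, hp.isIdempotentElem.eq, sub_self]
  exact sub_eq_zero.1 ((CStarRing.star_mul_self_eq_zero_iff _).1 hzero)

theorem mul_eq_self_of_mul_star_self_eq (hp : IsStarProjection p) (hv : v * star v = p) :
    p * v = v := by
  rw [← star_star v, mul_star_eq_star_iff hp.isSelfAdjoint]
  exact mul_eq_self_of_star_mul_self_eq hp (by rwa [star_star])

end MurrayVonNeumann

variable (A : Type u) [NonUnitalCStarAlgebra A]

/-- An atom of `A`: a nonzero minimal projection. -/
structure Atom where
  val : A
  isMinimalProjection : IsMinimalProjection val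
  ne_zero : val ≠ 0

namespace Atom

variable {A}

attribute [coe] Atom.val

instance : CoeOut (Atom A) A := ⟨Atom.val⟩

theorem isStarProjection (p : Atom A) : IsStarProjection (p : A) :=
  p.isMinimalProjection.isStarProjection

theorem mul_self (p : Atom A) : (p : A) * p = p := p.isMinimalProjection.mul_self

theorem star_eq (p : Atom A) : star (p : A) = p := p.isMinimalProjection.star_eq

variable (A) in
/-- Murray–von Neumann equivalence of atoms. -/
instance murrayVonNeumannSetoid : Setoid (Atom A) where
  r p q := ∃ v : A, star v * v = p ∧ v * star v = q
  iseqv :=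
    { refl p := ⟨p, by rw [p.star_eq, p.mul_self], by rw [p.star_eq, p.mul_self]⟩
      symm := fun ⟨v, hp, hq⟩ => ⟨star v, by rwa [star_star], by rwa [star_star]⟩
      trans := by
        rintro p q r ⟨v, hp, hq⟩ ⟨w, hq', hr⟩
        have hqv : (q : A) * v = v := mul_eq_self_of_mul_star_self_eq q.isStarProjection hq
        have hwq : w * (q : A) = w := mul_eq_self_of_star_mul_self_eq q.isStarProjection hq'
        refine ⟨w * v, ?_, ?_⟩
        · rw [star_mul, mul_assoc, ← mul_assoc (star w), hq', hqv, hp]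
        · rw [star_mul, mul_assoc, ← mul_assoc v, hq, ← mul_assoc, hwq, hr] }

theorem equiv_def {p q : Atom A} : p ≈ q ↔ ∃ v : A, star v * v = p ∧ v * star v = q := Iff.rfl

theorem equiv_of_ne_zero {p q : Atom A} {x : A} (hx0 : x ≠ 0) (hxp : x * p = x)
    (hqx : q * x = x) : p ≈ q := by
  have hxq : star x * (q : A) = star x := by
    rwa [← mul_star_eq_star_iff q.isStarProjection.isSelfAdjoint, star_star]
  have hx : (‖x‖ : ℂ) ≠ 0 := by simpa using hx0
  have hscale : (‖x‖ : ℂ)⁻¹ * (‖x‖ : ℂ)⁻¹ * ((‖x‖ ^ 2 : ℝ) : ℂ) = 1 := by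
    push_cast
    field_simp
  have star_inv : star ((‖x‖ : ℂ)⁻¹) = (‖x‖ : ℂ)⁻¹ := by
    rw [star_inv₀, Complex.star_def, Complex.conj_ofReal]
  refine equiv_def.2 ⟨(‖x‖ : ℂ)⁻¹ • x, ?_, ?_⟩
  · rw [star_smul, star_inv, smul_mul_smul_comm, p.isMinimalProjection.star_mul_self_eq hxp,
      smul_smul, hscale, one_smul]
  · have hxx := q.isMinimalProjection.star_mul_self_eq hxq
    rw [star_star, norm_star] at hxx
    rw [star_smul, star_inv, smul_mul_smul_comm, hxx, smul_smul, hscale, one_smul]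

/-- The pure state of an atom `p`: the linear functional with `p a p = state p a • p`. -/
noncomputable def state (p : Atom A) : A →ₗ[ℂ] ℂ :=
  LinearEquiv.coord ℂ A (p : A) p.ne_zero ∘ₗ
    (LinearMap.mulLeftRight ℂ ((p : A), (p : A))).codRestrict (ℂ ∙ (p : A)) fun a =>
      Submodule.mem_span_singleton.2
        ((p.isMinimalProjection.exists_mul_mul_eq_smul a).imp fun _ h => h.symm)

theorem state_smul (p : Atom A) (a : A) : p.state a • (p : A) = p * a * p :=
  LinearEquiv.coord_apply_smul ℂ A (p : A) p.ne_zero _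

theorem smul_injective (p : Atom A) : Function.Injective fun c : ℂ => c • (p : A) :=
  smul_left_injective ℂ p.ne_zero

theorem state_self (p : Atom A) : p.state p = 1 :=
  p.smul_injective <| by simp only [state_smul, p.mul_self, one_smul]

theorem state_star (p : Atom A) (a : A) : p.state (star a) = star (p.state a) :=
  p.smul_injective <| by
    calc p.state (star a) • (p : A) = star (p.state a • (p : A)) := by
          rw [state_smul, state_smul, star_mul, star_mul, p.star_eq, mul_assoc]
      _ = star (p.state a) • (p : A) := by rw [star_smul, p.star_eq]

theorem state_star_mul_self (p : Atom A) {x : A} (hx : x * p = x) :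
    p.state (star x * x) = ((‖x‖ ^ 2 : ℝ) : ℂ) := by
  rw [p.isMinimalProjection.star_mul_self_eq hx, map_smul, state_self, smul_eq_mul, mul_one]

/-- The inner product `⟪x, y⟫ = state p (x⋆ y)` induces the norm of `A` on `A p`. -/
noncomputable instance (p : Atom A) : InnerProductSpace ℂ (leftIdeal ℂ (p : A)) where
  inner x y := p.state (star (x : A) * y)
  norm_sq_eq_re_inner x := by
    rw [state_star_mul_self p x.2]
    exact (Complex.ofReal_re _).symm
  conj_inner_symm x y := by
    rw [← Complex.star_def, ← state_star, star_mul, star_star]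
  add_left x y z := by rw [Submodule.coe_add, star_add, add_mul, map_add]
  smul_left x y c := by
    rw [Submodule.coe_smul, star_smul, smul_mul_assoc, map_smul, smul_eq_mul, Complex.star_def]

theorem inner_eq_state (p : Atom A) (x y : leftIdeal ℂ (p : A)) :
    inner ℂ x y = p.state (star (x : A) * y) := rfl

theorem inner_smul (p : Atom A) (x y : leftIdeal ℂ (p : A)) :
    inner ℂ x y • (p : A) = star (x : A) * y := by
  rw [inner_eq_state, state_smul, ← mul_assoc,
    (mul_star_eq_star_iff p.isStarProjection.isSelfAdjoint).2 x.2, mul_assoc,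
    mem_leftIdeal.1 y.2]

theorem exists_mul_star_self_eq (q : Atom A) :
    ∃ v : leftIdeal ℂ ((⟦q⟧ : Quotient (murrayVonNeumannSetoid A)).out : A),
      (v : A) * star (v : A) = q := by
  obtain ⟨v, hp, hq⟩ := equiv_def.1 (Quotient.mk_out q)
  exact ⟨⟨v, mul_eq_self_of_star_mul_self_eq (isStarProjection _) hp⟩, hq⟩

end Atom

section RankOne

theorem isCompactOperator_rankOne {𝕜 E F : Type*} [RCLike 𝕜] [NormedAddCommGroup E]
    [NormedSpace 𝕜 E] [NormedAddCommGroup F] [InnerProductSpace 𝕜 F] (x : E) (y : F) :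
    IsCompactOperator (InnerProductSpace.rankOne 𝕜 x y) :=
  (isCompactOperator_of_locallyCompactSpace_dom (innerSL 𝕜 y)).clm_comp
    (ContinuousLinearMap.toSpanSingleton 𝕜 x)

end RankOne

section AtomicRepresentation

variable {A : Type u} [NonUnitalCStarAlgebra A]

instance (p : A) : CompleteSpace (leftIdeal ℂ p) :=
  have hclosed : IsClosed (leftIdeal ℂ p : Set A) :=
    isClosed_eq (continuous_mul_const p) continuous_id
  hclosed.completeSpace_coe

/-- Left multiplication by `a` on the left ideal `A p`. -/
noncomputable def leftMul (p a : A) : leftIdeal ℂ p →L[ℂ] leftIdeal ℂ p :=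
  (ContinuousLinearMap.mul ℂ A a).restrict fun x hx =>
    mem_leftIdeal.2 ((mul_assoc a x p).trans (congrArg (a * ·) hx))

theorem norm_leftMul_le (p a : A) : ‖leftMul p a‖ ≤ ‖a‖ :=
  ContinuousLinearMap.opNorm_le_bound _ (norm_nonneg a) fun x => norm_mul_le a (x : A)

variable (A) in
/-- The Hilbert sum of the spaces `A p`, one for each Murray–von Neumann class of atoms. -/
abbrev atomicSpace : Type u :=
  lp (fun i : Quotient (Atom.murrayVonNeumannSetoid A) => leftIdeal ℂ (i.out : A)) 2

theorem atomicSpace_ext {x y : atomicSpace A} (h : ∀ i, (x i : A) = y i) : x = y :=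
  lp.ext (funext fun i => Subtype.ext (h i))

variable (A) in
/-- The atomic representation: the action of `A` on `atomicSpace A` by left multiplication. -/
noncomputable def atomicRep : A →⋆ₙₐ[ℂ] (atomicSpace A →L[ℂ] atomicSpace A) where
  toFun a := lp.mapCLM 2 (fun i => leftMul (i.out : A) a) (norm_nonneg a)
    fun i => norm_leftMul_le (i.out : A) a
  map_smul' c a := by
    ext1 x
    exact atomicSpace_ext fun i => smul_mul_assoc c a (x i : A)
  map_zero' := by
    ext1 x
    exact atomicSpace_ext fun i => zero_mul (x i : A)
  map_add' a b := by
    ext1 x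
    exact atomicSpace_ext fun i => add_mul a b (x i : A)
  map_mul' a b := by
    ext1 x
    exact atomicSpace_ext fun i => mul_assoc a b (x i : A)
  map_star' a := by
    rw [ContinuousLinearMap.star_eq_adjoint, ContinuousLinearMap.eq_adjoint_iff]
    intro x y
    rw [lp.inner_eq_tsum, lp.inner_eq_tsum]
    refine tsum_congr fun i => congrArg i.out.state ?_
    change star (star a * (x i : A)) * y i = star (x i : A) * (a * y i)
    rw [star_mul, star_star, mul_assoc]

theorem atomicRep_apply (a : A) (x : atomicSpace A) (i) :
    (atomicRep A a x i : A) = a * x i := rfl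

/-- `w` is concentrated at the class of `q`; its coordinate there is a partial isometry `v` with
`v v⋆ = q`. -/
theorem exists_atomicRep_atom_eq_rankOne (q : Atom A) :
    ∃ w : atomicSpace A, atomicRep A q = InnerProductSpace.rankOne ℂ w w := by
  classical
  obtain ⟨v, hv⟩ := q.exists_mul_star_self_eq
  refine ⟨lp.single 2 ⟦q⟧ v, ContinuousLinearMap.ext fun x => atomicSpace_ext fun j => ?_⟩
  rw [atomicRep_apply, InnerProductSpace.rankOne_apply, lp.inner_single_left, lp.coeFn_smul,
    Pi.smul_apply, Submodule.coe_smul]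
  rcases eq_or_ne j ⟦q⟧ with rfl | hj
  · calc (q : A) * x ⟦q⟧ = v * (star (v : A) * x ⟦q⟧) := by rw [← hv, mul_assoc]
      _ = inner ℂ v (x ⟦q⟧) • (v : A) := by
        rw [← Atom.inner_smul _ v (x ⟦q⟧), mul_smul_comm, mem_leftIdeal.1 v.2]
      _ = _ := by rw [lp.single_apply_self]
  · rw [lp.single_apply_ne _ _ _ hj, Submodule.coe_zero, smul_zero]
    by_contra hne
    have hjq : j.out ≈ q := Atom.equiv_of_ne_zero hne
      (by rw [mul_assoc, mem_leftIdeal.1 (x j).2]) (by rw [← mul_assoc, q.mul_self])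
    exact hj (j.out_eq.symm.trans (Quotient.sound hjq))

open scoped CStarAlgebra in
theorem isCompactOperator_atomicRep {a : A} (ha : a ∈ atomicIdeal A) :
    IsCompactOperator (atomicRep A a) := by
  let K := (compactOperator (RingHom.id ℂ) (atomicSpace A) (atomicSpace A)).comap
    (atomicRep A : A →ₗ[ℂ] (atomicSpace A →L[ℂ] atomicSpace A))
  have hclosed : IsClosed (K : Set A) :=
    have hcompact : IsClosed {T : atomicSpace A →L[ℂ] atomicSpace A | IsCompactOperator T} :=
      isClosed_setOfPred_isCompactOperator
    hcompact.preimage (map_continuous (atomicRep A))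
  refine (atomicIdeal_le_iff hclosed).2 (fun q hq => ?_) ha
  rcases eq_or_ne q 0 with rfl | hq0
  · exact K.zero_mem
  · obtain ⟨w, hw⟩ := exists_atomicRep_atom_eq_rankOne ⟨q, hq, hq0⟩
    change IsCompactOperator (atomicRep A q)
    rw [hw]
    exact isCompactOperator_rankOne w w

theorem mul_atom_eq_zero_of_atomicRep_eq_zero {a : A} (ha : atomicRep A a = 0) (q : Atom A) :
    a * q = 0 := by
  classical
  obtain ⟨v, hv⟩ := q.exists_mul_star_self_eq
  have hav : a * (v : A) = 0 := by
    have happly := atomicRep_apply a (lp.single 2 ⟦q⟧ v) ⟦q⟧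
    rw [ha, lp.single_apply_self] at happly
    exact happly.symm
  rw [← hv, ← mul_assoc, hav, zero_mul]

theorem eq_zero_of_atomicRep_eq_zero {a : A} (hmem : a ∈ atomicIdeal A)
    (ha : atomicRep A a = 0) : a = 0 := by
  have hclosed : IsClosed (LinearMap.ker (LinearMap.mulLeft ℂ a) : Set A) :=
    isClosed_eq (continuous_const_mul a) continuous_const
  have hann : (atomicIdeal A).toSubmodule ≤ LinearMap.ker (LinearMap.mulLeft ℂ a) := by
    refine (atomicIdeal_le_iff hclosed).2 fun q hq => ?_
    rcases eq_or_ne q 0 with rfl | hq0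
    · exact zero_mem _
    · exact mul_atom_eq_zero_of_atomicRep_eq_zero ha ⟨q, hq, hq0⟩
  have hstar : star a ∈ atomicIdeal A := star_mem hmem
  exact (CStarRing.mul_star_self_eq_zero_iff a).1 (hann hstar)

variable (A) in
theorem isIsoToCompactSubalgebra_atomicIdeal :
    IsIsoToCompactSubalgebra.{u, u} (atomicIdeal A) := by
  have hclosed : IsClosed (atomicIdeal A : Set A) := (isClosedIdeal_atomicIdeal A).isClosed
  let ρ : atomicIdeal A →⋆ₙₐ[ℂ] (atomicSpace A →L[ℂ] atomicSpace A) :=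
    (atomicRep A).comp (NonUnitalStarSubalgebraClass.subtype (atomicIdeal A))
  have hinj : Function.Injective ρ := (injective_iff_map_eq_zero ρ).2 fun x hx =>
    Subtype.ext (eq_zero_of_atomicRep_eq_zero x.2 hx)
  refine ⟨atomicSpace A, inferInstance, inferInstance, inferInstance,
    NonUnitalStarAlgHom.range ρ, ?_, ?_, ⟨StarAlgEquiv.ofInjective' ρ hinj⟩⟩
  · rw [NonUnitalStarAlgHom.coe_range]
    exact (NonUnitalStarAlgHom.isometry ρ hinj).isClosedEmbedding.isClosed_range
  · intro T hT
    obtain ⟨x, rfl⟩ := (NonUnitalStarAlgHom.mem_range ρ).1 hT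
    exact isCompactOperator_atomicRep x.2

end AtomicRepresentation

end CStarAtoms

open CStarAtoms in
theorem mainTheorem1_general (A : Type u) [NonUnitalCStarAlgebra A] :
    IsClosedIdeal (atomicIdeal A).toSubmodule ∧
    IsIsoToCompactSubalgebra.{u, u} (atomicIdeal A) ∧
    (∀ (I : Submodule ℂ A) (hI : IsClosedIdeal I),
      HasFaithfulCompactRep.{w} hI.toStarSubalgebra → I ≤ (atomicIdeal A).toSubmodule) ∧
    (∀ (I : Submodule ℂ A) (hI : IsEssentialIdeal I),
      HasFaithfulCompactRep.{w} hI.1.toStarSubalgebra → I = (atomicIdeal A).toSubmodule) :=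
  ⟨isClosedIdeal_atomicIdeal A, isIsoToCompactSubalgebra_atomicIdeal A,
    fun _ hI hrep => hI.le_atomicIdeal hrep,
    fun _ hI hrep => le_antisymm (hI.1.le_atomicIdeal hrep) hI.atomicIdeal_le⟩

theorem mainTheorem1 (A : Type u) [NonUnitalCStarAlgebra A] :
    CStarAtoms.IsClosedIdeal (CStarAtoms.atomicIdeal A).toSubmodule ∧
    CStarAtoms.IsIsoToCompactSubalgebra.{u, u} (CStarAtoms.atomicIdeal A) ∧
    (∀ (I : Submodule ℂ A) (hI : CStarAtoms.IsClosedIdeal I),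
      CStarAtoms.IsIsoToCompactSubalgebra.{u, v} hI.toStarSubalgebra →
        I ≤ (CStarAtoms.atomicIdeal A).toSubmodule) ∧
    (∀ (I : Submodule ℂ A) (hI : CStarAtoms.IsEssentialIdeal I),
      CStarAtoms.IsIsoToCompactSubalgebra.{u, v} hI.1.toStarSubalgebra →
        I = (CStarAtoms.atomicIdeal A).toSubmodule) :=
  have ⟨hideal, hiso, hle, heq⟩ := mainTheorem1_general.{u, v} A
  ⟨hideal, hiso, fun I hI h => hle I hI h.hasFaithfulCompactRep,
    fun I hI h => heq I hI h.hasFaithfulCompactRep⟩
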